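/- Definitions. For $D\subseteq\mathbb R$ and $h:D\to\mathbb R$, a (finite or infinite) sequence $x_1>x_2>\cdots$ in $D$ is $h$-bad if $h(x_1)>h(x_2)>\cdots$, and $h$ is ordinal decreasing if there is no infinite $h$-bad sequence. For such $h$, the ordinal type $o(h)$ is the height of the root $\langle\rangle$ of the tree of finite $h$-bad sequences, in which the children of $\langle x_1,\dots,x_n\rangle$ are the $h$-bad sequences $\langle x_1,\dots,x_n,x_{n+1}\rangle$ and the height of a vertex $v$ is $o(v)=\sup\{o(w)+1 : w \text{ a child of } v\}$. The finite Veblen functions are $\varphi_0(\alpha)=\omega^\alpha$ and, for $n\in\mathbb N$, $\varphi_{n+1}(0)=\sup_{j}\varphi_n^{(j)}(0)$, $\varphi_{n+1}(\alpha+1)=\sup_{j}\varphi_n^{(j)}(\varphi_{n+1}(\alpha)+1)$, and $\varphi_{n+1}(\lambda)=\sup_{\beta<\lambda}\varphi_{n+1}(\beta)$ for limit $\lambda$, where $\varphi_n^{(j)}$ is the $j$-fold iterate of $\varphi_n$. Theorem. Let $k\ge 1$, let $f,g_1,\dots,g_k:(-\infty,0)\to(0,\infty)$ and $s:[0,\infty)\to(0,\infty)$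 be ordinal decreasing, and consider the recursive algorithm $$M(x)=\begin{cases} f(x), & x<0,\\ g_1(-M(x-g_2(-M(x-\cdots-g_k(-M(x-s(x)))\cdots)))), & x\ge 0.\end{cases}$$ Then the algorithm halts on every $x\in\mathbb R$, the function $M:\mathbb R\to\mathbb R$ that it computes is ordinal decreasing, and: 1. If $k=1$ and $\gamma$ is an ordinal with $\max\{o(f),o(s),o(g_1)\}<\omega^{\omega^\gamma}$, then $o(M)\le\omega^{\omega^{\gamma+1}(o(s)+1)}$. 2. If $k\ge 2$ and $\gamma$ is an ordinal with $\max\{o(f),o(s),o(g_1),\dots,o(g_k)\}<\varphi_{k-1}(\gamma)$, then $o(M)\le\varphi_{k-1}(\gamma+o(s)+1)$. -/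

import Mathlib

open scoped Ordinal

/-- `f` is ordinal decreasing on `D`: there is no infinite sequence `x₀ > x₁ > x₂ > ⋯` in `D`
with `f x₀ > f x₁ > f x₂ > ⋯`. -/
def OrdinalDecreasingOn (f : ℝ → ℝ) (D : Set ℝ) : Prop :=
  ¬ ∃ x : ℕ → ℝ, (∀ n, x n ∈ D) ∧ StrictAnti x ∧ StrictAnti (fun n => f (x n))

/-- A list is (the reversal of) a finite `f`-bad sequence in `D`: the sequence
`x₁ > ⋯ > xₙ` with `f x₁ > ⋯ > f xₙ` is stored with its last term first, as `[xₙ, …, x₁]`. -/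
def IsBadList (f : ℝ → ℝ) (D : Set ℝ) (l : List ℝ) : Prop :=
  (∀ x ∈ l, x ∈ D) ∧ l.Pairwise (fun b a => b < a ∧ f b < f a)

/-- The vertices of the tree of `f`-bad sequences in `D`. -/
def BadTree (f : ℝ → ℝ) (D : Set ℝ) : Type :=
  {l : List ℝ // IsBadList f D l}

namespace BadTree

/-- The root of the tree, the empty bad sequence. -/
def root (f : ℝ → ℝ) (D : Set ℝ) : BadTree f D :=
  ⟨[], by simp [IsBadList]⟩

/-- `w` is a child of `v`: the bad sequence `w` extends the bad sequence `v` by one last term. -/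
def IsChild {f : ℝ → ℝ} {D : Set ℝ} (w v : BadTree f D) : Prop :=
  ∃ x : ℝ, w.1 = x :: v.1

end BadTree

/-- The tree of bad sequences of an ordinal decreasing function has no infinite path. -/
theorem OrdinalDecreasingOn.wellFounded {f : ℝ → ℝ} {D : Set ℝ}
    (h : OrdinalDecreasingOn f D) :
    WellFounded (BadTree.IsChild (f := f) (D := D)) := by
  rw [wellFounded_iff_isEmpty_descending_chain]
  refine ⟨fun ⟨v, hv⟩ => h ?_⟩
  choose x hx using hv
  have key : ∀ n, x (n + 1) < x n ∧ f (x (n + 1)) < f (x n) := by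
    intro n
    have hp := (v (n + 2)).2.2
    have h2 : (v (n + 2)).1 = x (n + 1) :: x n :: (v n).1 := by rw [hx (n + 1), hx n]
    rw [h2, List.pairwise_cons] at hp
    exact hp.1 (x n) (by simp)
  refine ⟨x, fun n => (v (n + 1)).2.1 _ ?_, strictAnti_nat_of_succ_lt fun n => (key n).1,
    strictAnti_nat_of_succ_lt fun n => (key n).2⟩
  rw [hx n]
  simp

/-- The ordinal type `o(f)` of a function that is ordinal decreasing on `D`: the height of the
root of its tree of bad sequences, where the height of a vertex is the supremum of
`height w + 1` over its children `w`. -/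
noncomputable def OrdinalDecreasingOn.type {f : ℝ → ℝ} {D : Set ℝ}
    (h : OrdinalDecreasingOn f D) : Ordinal.{0} :=
  (h.wellFounded.apply (BadTree.root f D)).rank

/-- `Computes f s g x y`: on input `x`, the recursive algorithm
`M(x) = f(x)` if `x < 0`, and
`M(x) = g₁(-M(x - g₂(-M(x - ⋯ - gₖ(-M(x - s(x))) ⋯ ))))` if `x ≥ 0`,
halts with output `y`. In the second case a halting run on `x` consists of the intermediate
values `z` of the nested expression, from `z k = s(x)` outwards to the output `z 0`, and of the
halting runs of the recursive calls `M(x - z (i + 1))`, with outputs `r i`; each `r i` has to be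
positive, since the functions `gᵢ` are evaluated at negative arguments only. The index `i` of
`g` runs through `0, …, k - 1`. -/
inductive Computes (f s : ℝ → ℝ) {k : ℕ} (g : Fin k → ℝ → ℝ) : ℝ → ℝ → Prop
  | neg {x : ℝ} (hx : x < 0) : Computes f s g x (f x)
  | nonneg {x : ℝ} (hx : 0 ≤ x) (z : Fin (k + 1) → ℝ) (r : Fin k → ℝ)
      (hlast : z (Fin.last k) = s x)
      (hcall : ∀ i : Fin k, Computes f s g (x - z i.succ) (r i))
      (hpos : ∀ i : Fin k, -r i < 0)
      (hstep : ∀ i : Fin k, z i.castSucc = g i (-r i)) :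
      Computes f s g x (z 0)

/-! A function is ordinal decreasing exactly when its bad pairs can be ranked by ordinals, and the
least bound for such ranks is its type; `HeightLE` works with these rankings. Heights of unions are
bounded by natural sums. Heights of y ↦ h(y - s(y)) and y ↦ g(-h(y)) are bounded by natural products
(`HeightLE.of_cover`), because a bad pair of the composite makes the rank of one of the two factors
drop.

The bound on M is an induction on the rank of s(x). Put c = s(x). Points y < x with s(y) < c are
covered by the induction. If s(y) ≥ c, the innermost call at y lands at least c further left, so the
half-line below x is exhausted in finitely many steps of length c. For k = 1 a step adds only small
exponents, which keeps heights below ω^(ω^(γ+1)(ξ+1)). For k + 1 levels the innermost function is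
absorbed into s, and a step becomes a k-level recursion; heights below a value of φ_k are closed
under it (`nestedClosed_veblen`), since such a value is closed under the k-level bound.

This argument works on every initial segment where the algorithm halts, and it yields termination.
Let T be the infimum of the inputs outside the halting segment. If inputs arbitrarily close to T on
the right made calls outside the segment, the corresponding nested expression would take ever
smaller values, against its being ordinal decreasing. -/

namespace Ordinal

/-! ### Natural sums and powers of ω. -/

/-- The natural (Hessenberg) sum of two ordinals. -/
noncomputable def natSum (a b : Ordinal.{0}) : Ordinal.{0} :=
  max (⨆ x : Set.Iio a, Order.succ (natSum x.1 b)) (⨆ x : Set.Iio b, Order.succ (natSum a x.1))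
termination_by (a, b)
decreasing_by all_goals cases x; decreasing_tactic

theorem natSum_le_iff {a b c : Ordinal.{0}} :
    natSum a b ≤ c ↔ (∀ x < a, natSum x b < c) ∧ ∀ x < b, natSum a x < c := by
  rw [natSum]
  simp [Ordinal.iSup_le_iff]

theorem natSum_lt_natSum_left {a a' : Ordinal.{0}} (h : a' < a) (b : Ordinal.{0}) :
    natSum a' b < natSum a b :=
  (natSum_le_iff.1 le_rfl).1 a' h

theorem natSum_lt_natSum_right {b b' : Ordinal.{0}} (h : b' < b) (a : Ordinal.{0}) :
    natSum a b' < natSum a b :=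
  (natSum_le_iff.1 le_rfl).2 b' h

theorem natSum_le_natSum {a a' b b' : Ordinal.{0}} (ha : a' ≤ a) (hb : b' ≤ b) :
    natSum a' b' ≤ natSum a b :=
  ((fun b => (StrictMono.monotone fun _ _ h => natSum_lt_natSum_left h b :
    Monotone fun a => natSum a b)) b' ha).trans
  ((fun a => (StrictMono.monotone fun _ _ h => natSum_lt_natSum_right h a :
    Monotone fun b => natSum a b)) a hb)

theorem natSum_lt_natSum_of_lt_of_le {a a' b b' : Ordinal.{0}} (ha : a' < a) (hb : b' ≤ b) :
    natSum a' b' < natSum a b :=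
  (natSum_lt_natSum_left ha b').trans_le (natSum_le_natSum le_rfl hb)

theorem natSum_lt_natSum_of_le_of_lt {a a' b b' : Ordinal.{0}} (ha : a' ≤ a) (hb : b' < b) :
    natSum a' b' < natSum a b :=
  (natSum_lt_natSum_right hb a').trans_le (natSum_le_natSum ha le_rfl)

theorem natSum_zero_left (b : Ordinal.{0}) : natSum 0 b = b := by
  induction b using WellFoundedLT.induction with
  | ind b ih =>
    apply le_antisymm
    · rw [natSum_le_iff]
      refine ⟨fun x hx => absurd hx (not_lt_zero), fun x hx => by rwa [ih x hx]⟩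
    · refine le_of_forall_lt fun x hx => ?_
      have := natSum_lt_natSum_right hx 0
      rwa [ih x hx] at this

theorem natSum_natCast_le (n m : ℕ) : natSum n m ≤ ((n + m : ℕ) : Ordinal.{0}) := by
  induction hN : n + m using Nat.strong_induction_on generalizing n m with
  | _ N ih =>
    rw [natSum_le_iff]
    constructor
    · intro x hx
      obtain ⟨x, rfl⟩ := lt_omega0.1 (hx.trans (natCast_lt_omega0 n))
      have hx' : x < n := by exact_mod_cast hx
      refine (ih (x + m) (by omega) x m rfl).trans_lt ?_
      exact_mod_cast (by omega : x + m < N)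
    · intro x hx
      obtain ⟨x, rfl⟩ := lt_omega0.1 (hx.trans (natCast_lt_omega0 m))
      have hx' : x < m := by exact_mod_cast hx
      refine (ih (n + x) (by omega) n x rfl).trans_lt ?_
      exact_mod_cast (by omega : n + x < N)

theorem natSum_lt_omega0 {a b : Ordinal.{0}} (ha : a < ω) (hb : b < ω) : natSum a b < ω := by
  obtain ⟨n, rfl⟩ := lt_omega0.1 ha
  obtain ⟨m, rfl⟩ := lt_omega0.1 hb
  exact (natSum_natCast_le n m).trans_lt (natCast_lt_omega0 _)

theorem mul_add_lt_mul {P x y r : Ordinal.{0}} (hxy : x < y) (hr : r < P) : P * x + r < P * y :=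
  calc P * x + r < P * x + P := by gcongr
    _ = P * (x + 1) := by rw [mul_add, mul_one]
    _ ≤ P * y := by gcongr; exact Order.add_one_le_of_lt hxy

/-- Division by P: below P * x + r either the quotient drops, and the remainders do not matter as
their natural sum stays below P, or the quotient is x and the remainder drops. -/
theorem natSum_mul_add_le {P : Ordinal.{0}}
    (hP : ∀ a < P, ∀ b < P, natSum a b < P) :
    ∀ x y r r' : Ordinal.{0}, r < P → r' < P →
      natSum (P * x + r) (P * y + r') ≤ P * natSum x y + natSum r r' := by
  have key : ∀ a b : Ordinal.{0}, ∀ x y r r' : Ordinal.{0}, r < P → r' < P →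
      P * x + r = a → P * y + r' = b →
      natSum a b ≤ P * natSum x y + natSum r r' := by
    intro a
    induction a using WellFoundedLT.induction with
    | ind a iha =>
      intro b
      induction b using WellFoundedLT.induction with
      | ind b ihb =>
        rintro x y r r' hr hr' rfl rfl
        have hP0 : P ≠ 0 := (hr.trans_le' (zero_le)).ne'
        rw [natSum_le_iff]
        constructor
        · intro c hc
          have hcm : c % P < P := mod_lt c hP0
          refine (iha c hc _ (c / P) y (c % P) r' hcm hr' (div_add_mod c P) rfl).trans_lt ?_
          have hle : c / P ≤ x := by
            by_contra! hlt
            have := (mul_add_lt_mul hlt hr).trans_le (mul_div_le c P)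
            exact absurd hc this.not_gt
          rcases hle.lt_or_eq with hlt | heq
          · exact (mul_add_lt_mul (natSum_lt_natSum_left hlt y) (hP _ hcm _ hr')).trans_le
              le_self_add
          · rw [heq]
            have hlt : c % P < r := by
              rw [← div_add_mod c P, heq] at hc
              exact (add_lt_add_iff_left _).1 hc
            gcongr
            exact natSum_lt_natSum_left hlt r'
        · intro c hc
          have hcm : c % P < P := mod_lt c hP0
          refine (ihb c hc x (c / P) r (c % P) hr hcm rfl (div_add_mod c P)).trans_lt ?_
          have hle : c / P ≤ y := by
            by_contra! hlt
            have := (mul_add_lt_mul hlt hr').trans_le (mul_div_le c P)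
            exact absurd hc this.not_gt
          rcases hle.lt_or_eq with hlt | heq
          · exact (mul_add_lt_mul (natSum_lt_natSum_right hlt x) (hP _ hr _ hcm)).trans_le
              le_self_add
          · rw [heq]
            have hlt : c % P < r' := by
              rw [← div_add_mod c P, heq] at hc
              exact (add_lt_add_iff_left _).1 hc
            gcongr
            exact natSum_lt_natSum_right hlt r
  intro x y r r' hr hr'
  exact key _ _ x y r r' hr hr' rfl rfl

theorem natSum_lt_omega0_opow {d a b : Ordinal.{0}} (ha : a < ω ^ d) (hb : b < ω ^ d) :
    natSum a b < ω ^ d := by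
  induction d using WellFoundedLT.induction generalizing a b with
  | ind d ih =>
    rcases eq_or_ne d 0 with rfl | hd
    · rw [opow_zero, Order.lt_one_iff] at ha hb
      subst ha hb
      simp [natSum_zero_left]
    · obtain ⟨c, hc, n, hn⟩ := (lt_omega0_opow hd).1 ha
      obtain ⟨c', hc', m, hm⟩ := (lt_omega0_opow hd).1 hb
      set e := max c c' with he
      have hed : e < d := max_lt hc hc'
      have hpos : (ω : Ordinal.{0}) ^ e ≠ 0 := (opow_pos e omega0_pos).ne'
      -- Modulo ω ^ e both quotients are finite, so their natural sum is finite, and the remainders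
      -- are covered by the induction.
      have hq : ∀ {u v : Ordinal.{0}} {i : ℕ}, v ≤ e → u < ω ^ v * i → u / ω ^ e < ω := by
        intro u v i hv hu
        refine lt_of_le_of_lt ?_ (natCast_lt_omega0 i)
        refine ((lt_mul_iff_div_lt hpos).1 (hu.trans_le ?_)).le
        gcongr
        exact omega0_pos
      have h1 := natSum_mul_add_le (P := ω ^ e) (fun a ha b hb => ih e hed ha hb)
        (a / ω ^ e) (b / ω ^ e) (a % ω ^ e) (b % ω ^ e) (mod_lt _ hpos) (mod_lt _ hpos)
      rw [div_add_mod, div_add_mod] at h1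
      refine h1.trans_lt ?_
      have h2 := mul_add_lt_mul (natSum_lt_omega0 (hq (le_max_left c c') hn)
        (hq (le_max_right c c') hm)) (ih e hed (mod_lt a hpos) (mod_lt b hpos))
      refine h2.trans_le ?_
      rw [← opow_succ]
      exact opow_le_opow_right omega0_pos (Order.succ_le_of_lt hed)

/-- The quotient of a by ω ^ d is 0, so only the remainder of b changes. Applied to exponents, this
makes ω ^ (ω ^ d * z) absorb composition with functions of small height. -/
theorem natSum_lt_omega0_opow_mul {d z a b : Ordinal.{0}} (ha : a < ω ^ d)
    (hb : b < ω ^ d * z) : natSum a b < ω ^ d * z := by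
  have hpos : (ω : Ordinal.{0}) ^ d ≠ 0 := (opow_pos d omega0_pos).ne'
  have h1 := natSum_mul_add_le (P := ω ^ d) (fun a ha b hb => natSum_lt_omega0_opow ha hb)
    0 (b / ω ^ d) a (b % ω ^ d) ha (mod_lt _ hpos)
  rw [div_add_mod, mul_zero, zero_add, natSum_zero_left] at h1
  exact h1.trans_lt (mul_add_lt_mul ((lt_mul_iff_div_lt hpos).1 hb)
    (natSum_lt_omega0_opow ha (mod_lt _ hpos)))

end Ordinal

/-! ### Rankings of bad pairs. -/

open Ordinal Set

/-- `HeightLE h D α`: the points of `D` can be ranked by ordinals below `α` such that the rank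
drops along every `h`-bad pair. This is `o(h|D) ≤ α`, and `h` is ordinal decreasing on `D` iff
it holds for some `α`. -/
def HeightLE (h : ℝ → ℝ) (D : Set ℝ) (α : Ordinal.{0}) : Prop :=
  ∃ ρ : ℝ → Ordinal.{0}, (∀ x ∈ D, ρ x < α) ∧
    ∀ x ∈ D, ∀ y ∈ D, y < x → h y < h x → ρ y < ρ x

/-- `o(h|D) < α`. -/
def HeightLT (h : ℝ → ℝ) (D : Set ℝ) (α : Ordinal.{0}) : Prop :=
  ∃ β < α, HeightLE h D β

namespace HeightLE

variable {h g s : ℝ → ℝ} {D E N : Set ℝ} {α β a b : Ordinal.{0}}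

theorem mono (H : HeightLE h D α) (hE : E ⊆ D) (hα : α ≤ β) : HeightLE h E β := by
  obtain ⟨ρ, h1, h2⟩ := H
  exact ⟨ρ, fun x hx => (h1 x (hE hx)).trans_le hα,
    fun x hx y hy => h2 x (hE hx) y (hE hy)⟩

theorem empty (h : ℝ → ℝ) : HeightLE h ∅ 0 := ⟨fun _ => 0, by simp, by simp⟩

theorem congr (H : HeightLE h D α) (hg : EqOn g h D) : HeightLE g D α := by
  obtain ⟨ρ, h1, h2⟩ := H
  refine ⟨ρ, h1, fun x hx y hy hyx hlt => h2 x hx y hy hyx ?_⟩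
  rwa [hg hx, hg hy] at hlt

/-- A ranking can be replaced by one that is also monotone at points outside of `D`. -/
theorem exists_extension (H : HeightLE h D α) : ∃ ρ : ℝ → Ordinal.{0},
    (∀ x, ρ x ≤ α) ∧ (∀ x ∈ D, ρ x < α) ∧
    (∀ x y, y < x → h y < h x → ρ y ≤ ρ x) ∧
    ∀ x, ∀ y ∈ D, y < x → h y < h x → ρ y < ρ x := by
  obtain ⟨ρ, h1, h2⟩ := H
  -- The least rank forced by the points of D: at most ρ on D, and possibly equal to α elsewhere.
  let r : ℝ → Ordinal.{0} := fun x =>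
    ⨆ y : {y : ℝ // y ∈ D ∧ y < x ∧ h y < h x}, Order.succ (ρ y.1)
  have hr : ∀ x c, r x ≤ c ↔ ∀ y ∈ D, y < x → h y < h x → ρ y < c := by
    intro x c
    simp [r, Ordinal.iSup_le_iff]
  have hrD : ∀ x ∈ D, r x ≤ ρ x := fun x hx => (hr x _).2 fun y hy h3 h4 => h2 x hx y hy h3 h4
  refine ⟨r, fun x => (hr x _).2 fun y hy _ _ => h1 y hy,
    fun x hx => (hrD x hx).trans_lt (h1 x hx), fun x y hyx hlt => (hr y _).2 ?_, ?_⟩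
  · intro z hz hzy hlt'
    exact (hr x _).1 le_rfl z hz (hzy.trans hyx) (hlt'.trans hlt)
  · intro x y hy hyx hlt
    exact (hrD y hy).trans_lt ((hr x _).1 le_rfl y hy hyx hlt)

/-- The natural sum of the two extended ranks works: the rank belonging to the set that contains the
lower point drops strictly, the other one weakly. -/
theorem union (H : HeightLE h D α) (H' : HeightLE h E β) :
    HeightLE h (D ∪ E) (natSum α β) := by
  obtain ⟨ρ, r1, r2, r3, r4⟩ := H.exists_extension
  obtain ⟨σ, s1, s2, s3, s4⟩ := H'.exists_extension
  refine ⟨fun x => natSum (ρ x) (σ x), ?_, ?_⟩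
  · rintro x (hx | hx)
    · exact natSum_lt_natSum_of_lt_of_le (r2 x hx) (s1 x)
    · exact natSum_lt_natSum_of_le_of_lt (r1 x) (s2 x hx)
  · rintro x - y (hy | hy) hyx hlt
    · exact natSum_lt_natSum_of_lt_of_le (r4 x y hy hyx hlt) (s3 x y hyx hlt)
    · exact natSum_lt_natSum_of_le_of_lt (r3 x y hyx hlt) (s4 x y hy hyx hlt)

/-- The height is bounded by the successors of the heights below each of the points. -/
theorem of_forall_lt (H : ∀ x ∈ D, HeightLT h (D ∩ {y | y < x ∧ h y < h x}) α) :
    HeightLE h D α := by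
  let S : ℝ → Set Ordinal.{0} := fun x => {β | HeightLE h (D ∩ {y | y < x ∧ h y < h x}) β}
  refine ⟨fun x => sInf (S x), fun x hx => ?_, fun x hx y hy hyx hlt => ?_⟩
  · obtain ⟨β, hβ, H'⟩ := H x hx
    exact (csInf_le' (show β ∈ S x from H')).trans_lt hβ
  · have hne : (S x).Nonempty := by
      obtain ⟨β, -, H'⟩ := H x hx
      exact ⟨β, H'⟩
    obtain ⟨ρ, h1, h2⟩ : HeightLE h (D ∩ {y | y < x ∧ h y < h x}) (sInf (S x)) := csInf_mem hne
    have hy' : y ∈ D ∩ {y | y < x ∧ h y < h x} := ⟨hy, hyx, hlt⟩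
    -- The ranking that realizes the least height below x, restricted to the points below y, takes
    -- values less than ρ y.
    refine lt_of_le_of_lt (csInf_le' (show ρ y ∈ S y from ?_)) (h1 y hy')
    have hsub : ∀ z ∈ D ∩ {z | z < y ∧ h z < h y}, z ∈ D ∩ {y | y < x ∧ h y < h x} :=
      fun z hz => ⟨hz.1, hz.2.1.trans hyx, hz.2.2.trans hlt⟩
    exact ⟨ρ, fun z hz => h2 y hy' z (hsub z hz) hz.2.1 hz.2.2,
      fun z hz w hw => h2 z (hsub z hz) w (hsub w hw)⟩

end HeightLE

namespace HeightLT

variable {h g s : ℝ → ℝ} {D E N : Set ℝ} {α β d : Ordinal.{0}}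

theorem mono (H : HeightLT h D α) (hE : E ⊆ D) (hα : α ≤ β) : HeightLT h E β := by
  obtain ⟨γ, h1, h2⟩ := H
  exact ⟨γ, h1.trans_le hα, h2.mono hE le_rfl⟩

theorem congr (H : HeightLT h D α) (hg : EqOn g h D) : HeightLT g D α := by
  obtain ⟨γ, h1, h2⟩ := H
  exact ⟨γ, h1, h2.congr hg⟩

theorem union (H : HeightLT h D (ω ^ d)) (H' : HeightLT h E (ω ^ d)) :
    HeightLT h (D ∪ E) (ω ^ d) := by
  obtain ⟨γ, h1, h2⟩ := H
  obtain ⟨γ', h1', h2'⟩ := H'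
  exact ⟨_, natSum_lt_omega0_opow h1 h1', h2.union h2'⟩

end HeightLT

/-- If bad pairs of `h` make one of two ordinal valued functions drop, then the height is at most
the natural product of their bounds, for additively principal bounds. -/
theorem HeightLE.of_cover {h : ℝ → ℝ} (a b : Ordinal.{0}) :
    ∀ (D : Set ℝ) (p q : ℝ → Ordinal.{0}), (∀ x ∈ D, p x < ω ^ a) → (∀ x ∈ D, q x < ω ^ b) →
      (∀ x ∈ D, ∀ y ∈ D, y < x → h y < h x → p y < p x ∨ q y < q x) →
      HeightLE h D (ω ^ natSum a b) := by
  induction a using WellFoundedLT.induction generalizing b with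
  | ind a iha =>
  induction b using WellFoundedLT.induction with
  | ind b ihb =>
  intro D p q hp hq hpq
  have hpos : ∀ c : Ordinal.{0}, 0 < (ω : Ordinal.{0}) ^ c := fun c => opow_pos c omega0_pos
  have hempty : HeightLT h ∅ (ω ^ natSum a b) := ⟨0, hpos _, HeightLE.empty h⟩
  -- The set is cut into n slabs according to p. Subtracting the left endpoint of a slab brings p
  -- below ω ^ a', so the induction on a applies to each slab.
  have hP : ∀ a' < a, ∀ n : ℕ,
      HeightLT h {y ∈ D | p y < ω ^ a' * n} (ω ^ natSum a b) := by
    intro a' ha' n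
    induction n with
    | zero => simpa using hempty
    | succ n ih =>
      have h1 : HeightLE h {y ∈ D | ω ^ a' * n ≤ p y ∧ p y < ω ^ a' * (n + 1 : ℕ)}
          (ω ^ natSum a' b) := by
        refine iha a' ha' b _ (fun y => p y - ω ^ a' * n) q ?_ (fun x hx => hq x hx.1) ?_
        · rintro x ⟨hx, h1, h2⟩
          refine (sub_lt_of_le h1).2 ?_
          rwa [Nat.cast_succ, mul_add, mul_one] at h2
        · rintro x ⟨hx, h1, h2⟩ y ⟨hy, h3, h4⟩ hyx hlt
          refine (hpq x hx y hy hyx hlt).imp_left fun h5 => ?_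
          refine (sub_lt_of_le h3).2 ?_
          rwa [Ordinal.add_sub_cancel_of_le h1]
      refine (ih.union ⟨_, (opow_lt_opow_iff_right one_lt_omega0).2
        (natSum_lt_natSum_left ha' b), h1⟩).mono ?_ le_rfl
      rintro y ⟨hy, h2⟩
      rcases lt_or_ge (p y) (ω ^ a' * n) with h3 | h3
      · exact Or.inl ⟨hy, h3⟩
      · exact Or.inr ⟨hy, h3, h2⟩
  have hQ : ∀ b' < b, ∀ n : ℕ,
      HeightLT h {y ∈ D | q y < ω ^ b' * n} (ω ^ natSum a b) := by
    intro b' hb' n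
    induction n with
    | zero => simpa using hempty
    | succ n ih =>
      have h1 : HeightLE h {y ∈ D | ω ^ b' * n ≤ q y ∧ q y < ω ^ b' * (n + 1 : ℕ)}
          (ω ^ natSum a b') := by
        refine ihb b' hb' _ p (fun y => q y - ω ^ b' * n) (fun x hx => hp x hx.1) ?_ ?_
        · rintro x ⟨hx, h1, h2⟩
          refine (sub_lt_of_le h1).2 ?_
          rwa [Nat.cast_succ, mul_add, mul_one] at h2
        · rintro x ⟨hx, h1, h2⟩ y ⟨hy, h3, h4⟩ hyx hlt
          refine (hpq x hx y hy hyx hlt).imp_right fun h5 => ?_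
          refine (sub_lt_of_le h3).2 ?_
          rwa [Ordinal.add_sub_cancel_of_le h1]
      refine (ih.union ⟨_, (opow_lt_opow_iff_right one_lt_omega0).2
        (natSum_lt_natSum_right hb' a), h1⟩).mono ?_ le_rfl
      rintro y ⟨hy, h2⟩
      rcases lt_or_ge (q y) (ω ^ b' * n) with h3 | h3
      · exact Or.inl ⟨hy, h3⟩
      · exact Or.inr ⟨hy, h3, h2⟩
  have hP' : ∀ x ∈ D, HeightLT h {y ∈ D | p y < p x} (ω ^ natSum a b) := by
    intro x hx
    rcases eq_or_ne a 0 with rfl | ha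
    · have h0 := hp x hx
      rw [opow_zero, Order.lt_one_iff] at h0
      simpa [h0] using hempty
    · obtain ⟨a', ha', n, hn⟩ := (lt_omega0_opow ha).1 (hp x hx)
      exact (hP a' ha' n).mono (fun y hy => ⟨hy.1, hy.2.trans hn⟩) le_rfl
  have hQ' : ∀ x ∈ D, HeightLT h {y ∈ D | q y < q x} (ω ^ natSum a b) := by
    intro x hx
    rcases eq_or_ne b 0 with rfl | hb
    · have h0 := hq x hx
      rw [opow_zero, Order.lt_one_iff] at h0
      simpa [h0] using hempty
    · obtain ⟨b', hb', n, hn⟩ := (lt_omega0_opow hb).1 (hq x hx)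
      exact (hQ b' hb' n).mono (fun y hy => ⟨hy.1, hy.2.trans hn⟩) le_rfl
  refine HeightLE.of_forall_lt fun x hx => ((hP' x hx).union (hQ' x hx)).mono ?_ le_rfl
  rintro y ⟨hy, hyx, hlt⟩
  exact (hpq x hx y hy hyx hlt).imp (fun h => ⟨hy, h⟩) fun h => ⟨hy, h⟩

/-- The height of `y ↦ h (y - s y)`. -/
theorem HeightLE.comp_sub {h s : ℝ → ℝ} {D N : Set ℝ} {a b : Ordinal.{0}}
    (H : HeightLE h D (ω ^ a)) (H' : HeightLE s N (ω ^ b)) (hmaps : ∀ y ∈ N, y - s y ∈ D) :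
    HeightLE (fun y => h (y - s y)) N (ω ^ natSum b a) := by
  obtain ⟨ρ, r1, r2⟩ := H
  obtain ⟨σ, s1, s2⟩ := H'
  refine of_cover b a N σ (fun y => ρ (y - s y)) s1 (fun y hy => r1 _ (hmaps y hy)) ?_
  intro x hx y hy hyx hlt
  -- If the shifted points are not in decreasing order, then y < x forces s y < s x.
  rcases lt_or_ge (y - s y) (x - s x) with h1 | h1
  · exact Or.inr (r2 _ (hmaps x hx) _ (hmaps y hy) h1 hlt)
  · exact Or.inl (s2 x hx y hy hyx (by linarith))

/-- The height of `y ↦ g (-h y)`. -/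
theorem HeightLE.comp_neg {h g : ℝ → ℝ} {N : Set ℝ} {a b : Ordinal.{0}}
    (H : HeightLE h N (ω ^ a)) (H' : HeightLE g (Iio 0) (ω ^ b)) (hpos : ∀ y ∈ N, 0 < h y) :
    HeightLE (fun y => g (-h y)) N (ω ^ natSum b a) := by
  obtain ⟨ρ, r1, r2⟩ := H
  obtain ⟨σ, s1, s2⟩ := H'
  have hneg : ∀ y ∈ N, -h y ∈ Iio (0 : ℝ) := fun y hy => neg_lt_zero.2 (hpos y hy)
  refine of_cover b a N (fun y => σ (-h y)) ρ (fun y hy => s1 _ (hneg y hy)) r1 ?_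
  intro x hx y hy hyx hlt
  rcases lt_trichotomy (h y) (h x) with h1 | h1 | h1
  · exact Or.inr (r2 x hx y hy hyx h1)
  · simp [h1] at hlt
  · exact Or.inl (s2 _ (hneg x hx) _ (hneg y hy) (neg_lt_neg h1) hlt)

/-! ### Rankings and the tree of bad sequences. -/

theorem OrdinalDecreasingOn.of_heightLE {h : ℝ → ℝ} {D : Set ℝ} {α : Ordinal.{0}}
    (H : HeightLE h D α) : OrdinalDecreasingOn h D := by
  obtain ⟨ρ, -, h2⟩ := H
  rintro ⟨x, hx, hanti, hanti'⟩
  obtain ⟨n, hn⟩ := WellFounded.not_rel_apply_succ (r := (· < ·)) (fun n => ρ (x n))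
  exact hn (h2 _ (hx n) _ (hx (n + 1)) (hanti n.lt_succ_self) (hanti' n.lt_succ_self))

/-- The rank of x is the least tree rank of a bad sequence with last term x; a sequence attaining it
can be prolonged by y, which gives a child of smaller rank. -/
theorem OrdinalDecreasingOn.heightLE_type {h : ℝ → ℝ} {D : Set ℝ}
    (H : OrdinalDecreasingOn h D) : HeightLE h D H.type := by
  let rk : BadTree h D → Ordinal.{0} := fun v => (H.wellFounded.apply v).rank
  let S : ℝ → Set Ordinal.{0} := fun x => {α | ∃ v : BadTree h D, (∃ l, v.1 = x :: l) ∧ rk v = α}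
  have hrk : ∀ {w v : BadTree h D}, BadTree.IsChild w v → rk w < rk v := fun {w v} hwv =>
    Acc.rank_lt_of_rel _ hwv
  have hsing : ∀ x ∈ D, ∃ v : BadTree h D, v.1 = [x] := fun x hx =>
    ⟨⟨[x], by simpa [IsBadList] using hx⟩, rfl⟩
  refine ⟨fun x => sInf (S x), fun x hx => ?_, fun x hx y hy hyx hlt => ?_⟩
  · obtain ⟨v, hv⟩ := hsing x hx
    refine (csInf_le' (show rk v ∈ S x from ⟨v, ⟨[], hv⟩, rfl⟩)).trans_lt ?_
    exact hrk ⟨x, hv⟩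
  · obtain ⟨v₀, hv₀⟩ := hsing x hx
    obtain ⟨v, ⟨l, hl⟩, hv⟩ : sInf (S x) ∈ S x := csInf_mem ⟨rk v₀, v₀, ⟨[], hv₀⟩, rfl⟩
    have hbad : IsBadList h D (y :: v.1) := by
      obtain ⟨hm, hp⟩ := v.2
      refine ⟨fun z hz => ?_, List.pairwise_cons.2 ⟨fun z hz => ?_, hp⟩⟩
      · rcases List.mem_cons.1 hz with rfl | hz
        exacts [hy, hm z hz]
      · rw [hl] at hz hp
        rcases List.mem_cons.1 hz with rfl | hz
        · exact ⟨hyx, hlt⟩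
        · have := (List.pairwise_cons.1 hp).1 z hz
          exact ⟨hyx.trans this.1, hlt.trans this.2⟩
    refine lt_of_le_of_lt (csInf_le' (show rk ⟨_, hbad⟩ ∈ S y from ⟨_, ⟨_, rfl⟩, rfl⟩)) ?_
    change _ < sInf (S x)
    rw [← hv]
    exact hrk ⟨y, rfl⟩

theorem OrdinalDecreasingOn.type_le {h : ℝ → ℝ} {D : Set ℝ} {α : Ordinal.{0}}
    (H : OrdinalDecreasingOn h D) (H' : HeightLE h D α) : H.type ≤ α := by
  obtain ⟨ρ, h1, h2⟩ := H'
  have key : ∀ v : BadTree h D, ∀ hv : Acc BadTree.IsChild v, ∀ x l, v.1 = x :: l →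
      hv.rank ≤ ρ x := by
    intro v
    induction v using H.wellFounded.induction with
    | _ v ih =>
      intro hv x l hl
      rw [Acc.rank_eq]
      refine Ordinal.iSup_le fun w => Order.succ_le_of_lt ?_
      obtain ⟨w, y, hy⟩ := w
      refine (ih w ⟨y, hy⟩ _ y _ hy).trans_lt ?_
      obtain ⟨hm, hp⟩ := w.2
      rw [hy, hl] at hm hp
      have := (List.pairwise_cons.1 hp).1 x (by simp)
      exact h2 x (hm x (by simp)) y (hm y (by simp)) this.1 this.2
  rw [OrdinalDecreasingOn.type, Acc.rank_eq]
  refine Ordinal.iSup_le fun w => Order.succ_le_of_lt ?_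
  obtain ⟨w, y, hy⟩ := w
  refine (key w _ y _ hy).trans_lt (h1 y (w.2.1 y ?_))
  rw [hy]
  simp

/-! ### Height bounds for nested recursions. -/

/-- The nested expression `G (k-1) (-M (x - ⋯ - G 0 (-M (x - s x)) ⋯))`. -/
def nested (M : ℝ → ℝ) : (ℕ → ℝ → ℝ) → (ℝ → ℝ) → ℕ → ℝ → ℝ
  | _, s, 0 => s
  | G, s, k + 1 => nested M (fun j => G (j + 1)) (fun x => G 0 (-M (x - s x))) k

theorem nested_succ (M : ℝ → ℝ) (G : ℕ → ℝ → ℝ) (s : ℝ → ℝ) (k : ℕ) (x : ℝ) :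
    nested M G s (k + 1) x = G k (-M (x - nested M G s k x)) := by
  induction k generalizing G s with
  | zero => rfl
  | succ k ih => exact ih (fun j => G (j + 1)) _

/-- On the part `N` of its domain `D`, the positive function `M` satisfies the recursion
`M x = G (k-1) (-M (x - ⋯ - G 0 (-M (x - s x)) ⋯))`. -/
structure IsNestedRec (k : ℕ) (M : ℝ → ℝ) (D N : Set ℝ) (s : ℝ → ℝ) (G : ℕ → ℝ → ℝ) : Prop where
  lower : IsLowerSet D
  subset : N ⊆ D
  nonneg : N ⊆ Ici 0
  M_pos : ∀ x ∈ D, 0 < M x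
  s_pos : ∀ x ∈ N, 0 < s x
  G_pos : ∀ j < k, ∀ x < 0, 0 < G j x
  eq : ∀ x ∈ N, M x = nested M G s k x

namespace IsNestedRec

variable {k : ℕ} {M s : ℝ → ℝ} {D N : Set ℝ} {G : ℕ → ℝ → ℝ} {σ : Ordinal.{0}}

theorem sub_mem (R : IsNestedRec k M D N s G) {x : ℝ} (hx : x ∈ N) : x - s x ∈ D :=
  R.lower (by linarith [R.s_pos x hx]) (R.subset hx)

/-- Restricting the domain, and absorbing the innermost function into `s`. -/
theorem tail (R : IsNestedRec (k + 1) M D N s G) {D' N' : Set ℝ} (hD : IsLowerSet D')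
    (hD' : D' ⊆ D) (hN : N' ⊆ D') (hN' : N' ⊆ N) :
    IsNestedRec k M D' N' (fun x => G 0 (-M (x - s x))) (fun j => G (j + 1)) where
  lower := hD
  subset := hN
  nonneg := hN'.trans R.nonneg
  M_pos x hx := R.M_pos x (hD' hx)
  s_pos _ hx := R.G_pos 0 k.succ_pos _ (neg_lt_zero.2 (R.M_pos _ (R.sub_mem (hN' hx))))
  G_pos j hj := R.G_pos (j + 1) (Nat.succ_lt_succ hj)
  eq x hx := R.eq x (hN' hx)

/-- Bounds on the height of `M` by induction on the rank of `s`: between points at which `s` is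
smaller, the recursion descends in steps bounded from below. -/
theorem heightLE_of_step (R : IsNestedRec k M D N s G) {Ψ : Ordinal.{0} → Ordinal.{0}}
    (hΨ : Monotone Ψ) (Hs : HeightLE s N σ) (h0 : HeightLT M (D \ N) (Ψ 1))
    (step : ∀ ξ c t, 0 < c → HeightLE M {y ∈ N | y < t ∧ s y < c} (Ψ ξ) →
      HeightLT M (D ∩ Iio (t - c)) (Ψ (ξ + 1)) → HeightLT M (D ∩ Iio t) (Ψ (ξ + 1))) :
    HeightLE M N (Ψ σ) := by
  obtain ⟨ρ, h1, h2⟩ := Hs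
  have key : ∀ ξ, ∀ x ∈ N, ρ x = ξ → HeightLT M (D ∩ Iio x) (Ψ (ξ + 1)) := by
    intro ξ
    induction ξ using WellFoundedLT.induction with
    | ind ξ ih =>
    intro x hx hξ
    have hsub : ∀ y : ℝ, N ∩ {z | z < y ∧ M z < M y} ⊆ D ∩ Iio y :=
      fun y z hz => ⟨R.subset hz.1, hz.2.1⟩
    have hE : ∀ t ≤ x, HeightLE M {y ∈ N | y < t ∧ s y < s x} (Ψ ξ) := by
      intro t ht
      refine HeightLE.of_forall_lt fun y hy => ?_
      have hlt : ρ y < ξ := hξ ▸ h2 x hx y hy.1 (hy.2.1.trans_le ht) hy.2.2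
      exact (ih _ hlt y hy.1 rfl).mono (fun z hz => hsub y ⟨hz.1.1, hz.2⟩)
        (hΨ (Order.add_one_le_of_lt hlt))
    -- Steps of length s x; for n = 0 nothing below t lies in N, whose points are nonnegative.
    have hn : ∀ n : ℕ, ∀ t ≤ x, t ≤ n * s x → HeightLT M (D ∩ Iio t) (Ψ (ξ + 1)) := by
      intro n
      induction n with
      | zero =>
        intro t _ ht
        refine h0.mono (fun y hy => ⟨hy.1, fun hyN => ?_⟩) (hΨ le_add_self)
        have h3 : (0 : ℝ) ≤ y := R.nonneg hyN
        have h4 : y < t := hy.2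
        simp only [Nat.cast_zero, zero_mul] at ht
        linarith
      | succ n ihn =>
        intro t ht ht'
        have hc := R.s_pos x hx
        refine step ξ (s x) t hc (hE t ht) (ihn _ (by linarith) ?_)
        push_cast at ht'
        linarith
    obtain ⟨n, hn'⟩ := exists_nat_ge (x / s x)
    exact hn n x le_rfl ((div_le_iff₀ (R.s_pos x hx)).1 hn')
  refine HeightLE.of_forall_lt fun x hx => (key _ x hx rfl).mono ?_
    (hΨ (Order.add_one_le_of_lt (h1 x hx)))
  exact fun z hz => ⟨R.subset hz.1, hz.2.1⟩

/-- Here the step may also use the bound on D \ N, since Ψ (ξ + 1) is a power of ω and so absorbs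
unions. -/
theorem heightLT_of_step (R : IsNestedRec k M D N s G) {Ψ : Ordinal.{0} → Ordinal.{0}}
    (hΨ : StrictMono Ψ) (hΨ' : ∀ ξ, ∃ d : Ordinal.{0}, Ψ (ξ + 1) = ω ^ d) (Hs : HeightLE s N σ)
    (h0 : HeightLT M (D \ N) (Ψ 1))
    (step : ∀ ξ c t, 0 < c → HeightLT M {y ∈ D | y < t ∧ ¬ (y ∈ N ∧ c ≤ s y)} (Ψ (ξ + 1)) →
      HeightLT M (D ∩ Iio (t - c)) (Ψ (ξ + 1)) → HeightLT M (D ∩ Iio t) (Ψ (ξ + 1))) :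
    HeightLT M D (Ψ (σ + 1)) := by
  have hunion : ∀ {A B : Set ℝ} {ξ}, HeightLE M A (Ψ ξ) → HeightLT M B (Ψ 1) →
      HeightLT M (A ∪ B) (Ψ (ξ + 1)) := by
    intro A B ξ hA hB
    obtain ⟨d, hd⟩ := hΨ' ξ
    have h1 : HeightLT M A (Ψ (ξ + 1)) := ⟨_, hΨ (lt_add_one ξ), hA⟩
    have h2 : HeightLT M B (Ψ (ξ + 1)) := hB.mono Subset.rfl (hΨ.monotone le_add_self)
    rw [hd] at h1 h2 ⊢
    exact h1.union h2
  have hN : HeightLE M N (Ψ σ) := by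
    refine R.heightLE_of_step hΨ.monotone Hs h0 fun ξ c t hc hE hD => step ξ c t hc ?_ hD
    refine (hunion hE h0).mono ?_ le_rfl
    rintro y ⟨hy, hyt, hyN⟩
    by_cases h : y ∈ N
    · exact Or.inl ⟨h, hyt, not_le.1 fun h' => hyN ⟨h, h'⟩⟩
    · exact Or.inr ⟨hy, h⟩
  refine (hunion hN h0).mono (fun y hy => ?_) le_rfl
  by_cases h : y ∈ N
  exacts [Or.inl h, Or.inr ⟨hy, h⟩]

end IsNestedRec

theorem HeightLT.exists_opow {h : ℝ → ℝ} {D : Set ℝ} {E : Ordinal.{0}} (hE : Order.IsSuccLimit E)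
    (H : HeightLT h D (ω ^ E)) : ∃ a < E, HeightLE h D (ω ^ a) := by
  obtain ⟨β, hβ, H⟩ := H
  obtain ⟨c, hc, n, hn⟩ := (lt_omega0_opow hE.bot_lt.ne').1 hβ
  refine ⟨c + 1, hE.add_one_lt hc, H.mono Subset.rfl (hn.le.trans ?_)⟩
  rw [opow_add, opow_one]
  gcongr
  exact (natCast_lt_omega0 n).le

/-- One level of nesting does not leave the heights below suitable powers of `ω`. -/
theorem HeightLT.comp_step {M g s : ℝ → ℝ} {D N : Set ℝ} {d z a b : Ordinal.{0}} (hd : d ≠ 0)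
    (hz : z ≠ 0) (hM : HeightLT M D (ω ^ (ω ^ d * z))) (hs : HeightLE s N (ω ^ a))
    (hg : HeightLE g (Iio 0) (ω ^ b)) (ha : a < ω ^ d) (hb : b < ω ^ d)
    (hmaps : ∀ y ∈ N, y - s y ∈ D) (hpos : ∀ y ∈ D, 0 < M y) :
    HeightLT (fun y => g (-M (y - s y))) N (ω ^ (ω ^ d * z)) := by
  have hlim : Order.IsSuccLimit (ω ^ d * z : Ordinal.{0}) :=
    isSuccLimit_mul_left (isSuccLimit_opow_left isSuccLimit_omega0 hd) (pos_iff_ne_zero.2 hz)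
  obtain ⟨e, he, hM⟩ := hM.exists_opow hlim
  refine ⟨_, ?_, (hM.comp_sub hs hmaps).comp_neg hg fun y hy => hpos _ (hmaps y hy)⟩
  exact (opow_lt_opow_iff_right one_lt_omega0).2
    (natSum_lt_omega0_opow_mul hb (natSum_lt_omega0_opow_mul ha he))

namespace IsNestedRec

variable {k : ℕ} {M s : ℝ → ℝ} {D N : Set ℝ} {G : ℕ → ℝ → ℝ} {σ γ : Ordinal.{0}}

theorem diff_subset (D N : Set ℝ) (s : ℝ → ℝ) (c t : ℝ) :
    (D ∩ Iio t) \ {y ∈ N | y < t ∧ c ≤ s y} ⊆ {y ∈ D | y < t ∧ ¬ (y ∈ N ∧ c ≤ s y)} :=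
  fun _ hy => ⟨hy.1.1, hy.1.2, fun h => hy.2 ⟨h.1, hy.1.2, h.2⟩⟩

theorem sub_mem_Iio (R : IsNestedRec k M D N s G) {c t y : ℝ}
    (hy : y ∈ {y ∈ N | y < t ∧ c ≤ s y}) : y - s y ∈ D ∩ Iio (t - c) :=
  ⟨R.sub_mem hy.1, by have := hy.2.1; have := hy.2.2; simp only [mem_Iio]; linarith⟩

theorem isLowerSet_inter_Iio (R : IsNestedRec k M D N s G) (t : ℝ) : IsLowerSet (D ∩ Iio t) :=
  R.lower.inter (isLowerSet_Iio t)

/-- The height bound for the recursion without nesting. -/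
theorem heightLT_one (R : IsNestedRec 1 M D N s G) (Hs : HeightLE s N σ)
    (h0 : HeightLT M (D \ N) (ω ^ (ω ^ γ))) (hs : HeightLE s N (ω ^ (ω ^ γ)))
    (hG : HeightLE (G 0) (Iio 0) (ω ^ (ω ^ γ))) :
    HeightLT M D (ω ^ (ω ^ (γ + 1) * (σ + 1))) := by
  have hlt : (ω ^ γ : Ordinal.{0}) < ω ^ (γ + 1) :=
    (opow_lt_opow_iff_right one_lt_omega0).2 (lt_add_one γ)
  have hmono : StrictMono fun ξ : Ordinal.{0} => (ω : Ordinal.{0}) ^ (ω ^ (γ + 1) * ξ) := by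
    intro a b hab
    refine (opow_lt_opow_iff_right one_lt_omega0).2 ?_
    exact (mul_lt_mul_iff_right₀ (opow_pos _ omega0_pos)).2 hab
  refine R.heightLT_of_step hmono (fun ξ => ⟨_, rfl⟩) Hs
    (h0.mono Subset.rfl ?_) fun ξ c t hc hE hD => ?_
  · simpa using opow_le_opow_right omega0_pos hlt.le
  · have h1 : HeightLT (fun y => G 0 (-M (y - s y))) {y ∈ N | y < t ∧ c ≤ s y}
        (ω ^ (ω ^ (γ + 1) * (ξ + 1))) :=
      HeightLT.comp_step (by simp) (by simp) hD
        (hs.mono (fun y hy => hy.1) le_rfl) hG hlt hlt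
        (fun y hy => R.sub_mem_Iio hy) fun y hy => R.M_pos y hy.1
    have h2 := HeightLT.congr (g := M) h1 fun y hy => R.eq y hy.1
    refine (hE.union h2).mono (fun y hy => ?_) le_rfl
    by_cases h : y ∈ N ∧ c ≤ s y
    exacts [Or.inr ⟨h.1, hy.2, h.2⟩, Or.inl ⟨hy.1, hy.2, h⟩]

end IsNestedRec

/-! ### Closure of Veblen values under nesting. -/

/-- The ordinals below `Ψ` are closed under the recursion with `k` levels. -/
def NestedClosed (k : ℕ) (Ψ : Ordinal.{0}) : Prop :=
  ∀ (M : ℝ → ℝ) (D N : Set ℝ) (s : ℝ → ℝ) (G : ℕ → ℝ → ℝ), IsNestedRec k M D N s G →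
    HeightLT M (D \ N) Ψ → HeightLT s N Ψ → (∀ j < k, HeightLT (G j) (Iio 0) Ψ) →
    HeightLT M D Ψ

theorem omega0_opow_veblen_add_one (o γ : Ordinal.{0}) :
    ω ^ veblen (o + 1) γ = veblen (o + 1) γ := by
  have := veblen_veblen_of_lt (o₁ := 0) (o₂ := o + 1) (by simp) γ
  rwa [veblen_zero_apply] at this

namespace IsNestedRec

variable {k : ℕ} {M s : ℝ → ℝ} {D N : Set ℝ} {G : ℕ → ℝ → ℝ} {σ γ o : Ordinal.{0}}

/-- The height bound for one more level of nesting. -/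
theorem heightLT_succ (hk : ∀ δ, NestedClosed k (veblen (o + 1) δ))
    (R : IsNestedRec (k + 1) M D N s G) (Hs : HeightLE s N σ)
    (h0 : HeightLT M (D \ N) (veblen (o + 1) γ)) (hs : HeightLT s N (veblen (o + 1) γ))
    (hG : ∀ j < k + 1, HeightLT (G j) (Iio 0) (veblen (o + 1) γ)) :
    HeightLT M D (veblen (o + 1) (γ + σ + 1)) := by
  have hmono : StrictMono fun ξ : Ordinal.{0} => veblen (o + 1) (γ + ξ) := fun a b hab =>
    veblen_right_strictMono _ (by gcongr)
  have hle : ∀ ξ, veblen (o + 1) γ ≤ veblen (o + 1) (γ + ξ) := fun ξ =>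
    veblen_le_veblen_iff_right.2 le_self_add
  -- Puts the Veblen value into the form required by `HeightLT.comp_step`, with z = 1.
  have hpow : ∀ ξ, veblen (o + 1) ξ = ω ^ (ω ^ veblen (o + 1) ξ * 1) := by
    intro ξ
    rw [mul_one, omega0_opow_veblen_add_one, omega0_opow_veblen_add_one]
  rw [add_assoc]
  refine R.heightLT_of_step hmono (fun ξ => ⟨_, hpow _⟩) Hs (h0.mono Subset.rfl (hle _))
    fun ξ c t hc hE hD => ?_
  set δ := γ + (ξ + 1) with hδ
  have hbelow : ∀ {h : ℝ → ℝ} {E : Set ℝ}, HeightLT h E (veblen (o + 1) γ) →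
      ∃ a < (ω : Ordinal.{0}) ^ veblen (o + 1) δ, HeightLE h E (ω ^ a) := by
    rintro h E ⟨a, ha, H⟩
    refine ⟨a, ?_, H.mono Subset.rfl (right_le_opow a one_lt_omega0)⟩
    rw [omega0_opow_veblen_add_one]
    exact ha.trans_le (hle _)
  obtain ⟨a, ha, hsa⟩ := hbelow hs
  obtain ⟨b, hb, hgb⟩ := hbelow (hG 0 k.succ_pos)
  have h1 : HeightLT (fun y => G 0 (-M (y - s y))) {y ∈ N | y < t ∧ c ≤ s y}
      (veblen (o + 1) δ) := by
    rw [hpow] at hD ⊢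
    exact HeightLT.comp_step veblen_pos.ne' one_ne_zero hD
      (hsa.mono (fun y hy => hy.1) le_rfl) hgb ha hb
      (fun y hy => R.sub_mem_Iio hy) fun y hy => R.M_pos y hy.1
  -- The innermost function now plays the role of s, and the points with s y < c join the
  -- exceptional set, which `hE` bounds.
  refine hk δ M _ {y ∈ N | y < t ∧ c ≤ s y} _ _
    (R.tail (R.isLowerSet_inter_Iio t) inter_subset_left
      (fun y hy => ⟨R.subset hy.1, hy.2.1⟩) fun y hy => hy.1)
    (hE.mono (diff_subset D N s c t) le_rfl) h1 fun j hj => ?_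
  exact (hG (j + 1) (Nat.succ_lt_succ hj)).mono Subset.rfl (hle _)

end IsNestedRec

theorem HeightLT.exists_uniform {G : ℕ → ℝ → ℝ} {E : Set ℝ} {Ψ : Ordinal.{0}} (hΨ : 0 < Ψ) (k : ℕ)
    (hG : ∀ j < k, HeightLT (G j) E Ψ) : ∃ α < Ψ, ∀ j < k, HeightLE (G j) E α := by
  induction k with
  | zero => exact ⟨0, hΨ, by simp⟩
  | succ k ih =>
    obtain ⟨α, hα, h⟩ := ih fun j hj => hG j (hj.trans k.lt_succ_self)
    obtain ⟨β, hβ, h'⟩ := hG k k.lt_succ_self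
    refine ⟨max α β, max_lt hα hβ, fun j hj => ?_⟩
    rcases Nat.lt_succ_iff_lt_or_eq.1 hj with hj | rfl
    exacts [(h j hj).mono Subset.rfl (le_max_left _ _), h'.mono Subset.rfl (le_max_right _ _)]

/-- One level is handled by `heightLT_one`, as an ε-number is closed under products and powers of ω.
Further levels use `heightLT_succ`, as a value of the next Veblen function is a fixed point of the
one occurring in that bound. -/
theorem nestedClosed_veblen (k : ℕ) (δ : Ordinal.{0}) :
    NestedClosed (k + 1) (veblen ((k : Ordinal.{0}) + 1) δ) := by
  induction k generalizing δ with
  | zero =>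
    intro M D N s G R ⟨α, hα, h0⟩ ⟨σ, hσ, hs⟩ hG
    obtain ⟨β, hβ, hG⟩ := hG 0 Nat.one_pos
    simp only [Nat.cast_zero] at hα hσ hβ ⊢
    set Ψ := veblen (0 + 1) δ with hΨ
    have hpow : ω ^ Ψ = Ψ := omega0_opow_veblen_add_one 0 δ
    have hlim : Order.IsSuccLimit Ψ :=
      hpow ▸ isSuccLimit_opow_left isSuccLimit_omega0 veblen_pos.ne'
    have hmul : ∀ a < Ψ, ∀ b < Ψ, a * b < Ψ := by
      have := isPrincipal_mul_omega0_opow_opow Ψ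
      rw [hpow, hpow] at this
      exact fun a ha b hb => this ha hb
    have hopow : ∀ a < Ψ, ω ^ a < Ψ := fun a ha => by
      rw [← hpow]
      exact (opow_lt_opow_iff_right one_lt_omega0).2 ha
    set γ := max α (max σ β) + 1 with hγ
    have hγΨ : γ < Ψ := hlim.add_one_lt (max_lt hα (max_lt hσ hβ))
    have hle : γ ≤ ω ^ (ω ^ γ) :=
      (right_le_opow γ one_lt_omega0).trans (right_le_opow _ one_lt_omega0)
    have hαγ : α < γ := Order.lt_add_one_iff.2 (le_max_left _ _)
    have hσγ : σ < γ := Order.lt_add_one_iff.2 ((le_max_left _ _).trans (le_max_right _ _))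
    have hβγ : β < γ := Order.lt_add_one_iff.2 ((le_max_right _ _).trans (le_max_right _ _))
    refine (R.heightLT_one hs ⟨α, hαγ.trans_le hle, h0⟩ (hs.mono Subset.rfl (hσγ.le.trans hle))
      (hG.mono Subset.rfl (hβγ.le.trans hle))).mono Subset.rfl (hopow _ ?_).le
    exact hmul _ (hopow _ (hlim.add_one_lt hγΨ)) _ (hlim.add_one_lt hσ)
  | succ k ih =>
    intro M D N s G R ⟨α, hα, h0⟩ ⟨σ, hσ, hs⟩ hG
    obtain ⟨β, hβ, hG⟩ := HeightLT.exists_uniform veblen_pos _ hG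
    rw [Nat.cast_succ] at hα hσ hβ ⊢
    set Ψ := veblen ((k : Ordinal.{0}) + 1 + 1) δ with hΨ
    have hpow : ω ^ Ψ = Ψ := omega0_opow_veblen_add_one _ δ
    have hfix : veblen ((k : Ordinal.{0}) + 1) Ψ = Ψ := veblen_veblen_of_lt (lt_add_one _) δ
    have hlim : Order.IsSuccLimit Ψ :=
      hpow ▸ isSuccLimit_opow_left isSuccLimit_omega0 veblen_pos.ne'
    have hadd : ∀ a < Ψ, ∀ b < Ψ, a + b < Ψ := by
      have := isPrincipal_add_omega0_opow Ψ
      rw [hpow] at this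
      exact fun a ha b hb => this ha hb
    set γ := max α (max σ β) + 1 with hγ
    have hγΨ : γ < Ψ := hlim.add_one_lt (max_lt hα (max_lt hσ hβ))
    have hle : γ ≤ veblen ((k : Ordinal.{0}) + 1) γ := right_le_veblen _ _
    have hαγ : α < γ := Order.lt_add_one_iff.2 (le_max_left _ _)
    have hσγ : σ < γ := Order.lt_add_one_iff.2 ((le_max_left _ _).trans (le_max_right _ _))
    have hβγ : β < γ := Order.lt_add_one_iff.2 ((le_max_right _ _).trans (le_max_right _ _))
    refine (IsNestedRec.heightLT_succ ih R hs ⟨α, hαγ.trans_le hle, h0⟩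
      ⟨σ, hσγ.trans_le hle, hs⟩ fun j hj => ⟨β, hβγ.trans_le hle, hG j hj⟩).mono Subset.rfl ?_
    rw [← hfix]
    exact veblen_le_veblen_iff_right.2 (hlim.add_one_lt (hadd _ hγΨ _ hσ)).le

/-! ### Termination. -/

theorem nested_pos {M s : ℝ → ℝ} {G : ℕ → ℝ → ℝ} {k : ℕ} (hM : ∀ x, 0 < M x)
    (hG : ∀ j < k, ∀ x < 0, 0 < G j x) {x : ℝ} (hs : 0 < s x) {j : ℕ} (hj : j ≤ k) :
    0 < nested M G s j x := by
  cases j with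
  | zero => exact hs
  | succ j =>
    rw [nested_succ]
    exact hG j hj _ (neg_lt_zero.2 (hM _))

/-- The nested expressions are ordinal decreasing where their arguments stay in `D`. -/
theorem exists_heightLE_nested {M s : ℝ → ℝ} {G : ℕ → ℝ → ℝ} {k : ℕ} {D : Set ℝ} {α σ : Ordinal.{0}}
    (hM : ∀ x, 0 < M x) (hMD : HeightLE M D α) (hs : HeightLE s (Ici 0) σ)
    (hG : ∀ j < k, ∃ β, HeightLE (G j) (Iio 0) β) {j : ℕ} (hj : j ≤ k) :
    ∃ β, HeightLE (nested M G s j) {x | 0 ≤ x ∧ ∀ i < j, x - nested M G s i x ∈ D} β := by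
  have hω : ∀ {h : ℝ → ℝ} {E : Set ℝ} {β : Ordinal.{0}}, HeightLE h E β → HeightLE h E (ω ^ β) :=
    fun H => H.mono Subset.rfl (right_le_opow _ one_lt_omega0)
  induction j with
  | zero => exact ⟨σ, hs.mono (fun x hx => hx.1) le_rfl⟩
  | succ j ih =>
    obtain ⟨β, hβ⟩ := ih (Nat.le_of_succ_le hj)
    obtain ⟨β', hβ'⟩ := hG j hj
    have h1 : HeightLE (nested M G s j)
        {x | 0 ≤ x ∧ ∀ i < j + 1, x - nested M G s i x ∈ D} β :=
      hβ.mono (fun x hx => ⟨hx.1, fun i hi => hx.2 i (hi.trans j.lt_succ_self)⟩) le_rfl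
    have h2 := ((hω hMD).comp_sub (hω h1) fun x hx => hx.2 j j.lt_succ_self).comp_neg (hω hβ')
      fun y _ => hM _
    exact ⟨_, h2.congr fun x _ => nested_succ M G s j x⟩

/-- The induction principle behind the termination of the nested recursion. -/
theorem forall_of_nested_step {M s : ℝ → ℝ} {G : ℕ → ℝ → ℝ} {k : ℕ} {H : ℝ → Prop}
    {α σ : Ordinal.{0}} (hM : ∀ x, 0 < M x) (hs_pos : ∀ x, 0 ≤ x → 0 < s x)
    (hG_pos : ∀ j < k, ∀ x < 0, 0 < G j x) (hMD : HeightLE M {x | ∀ y ≤ x, H y} α)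
    (hs : HeightLE s (Ici 0) σ) (hG : ∀ j < k, ∃ β, HeightLE (G j) (Iio 0) β)
    (hneg : ∀ x < 0, H x)
    (hstep : ∀ x, 0 ≤ x → (∀ j < k, H (x - nested M G s j x)) → H x) (x : ℝ) : H x := by
  set D : Set ℝ := {x | ∀ y ≤ x, H y} with hD
  have hDH : ∀ x ∈ D, H x := fun x hx => hx x le_rfl
  have hlower : ∀ x ∈ D, ∀ y ≤ x, y ∈ D := fun x hx y hy z hz => hx z (hz.trans hy)
  by_contra hx
  set C : Set ℝ := {x | x ∉ D} with hC
  have hne : C.Nonempty := ⟨x, fun h => hx (hDH x h)⟩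
  have hbdd : ∀ y ∈ C, 0 ≤ y := by
    intro y hy
    by_contra! h
    exact hy fun z hz => hneg z (hz.trans_lt h)
  set T := sInf C with hT
  have hT0 : 0 ≤ T := le_csInf hne hbdd
  have hltT : ∀ y < T, y ∈ D := fun y hy => by
    by_contra h
    exact (csInf_le ⟨0, hbdd⟩ (show y ∈ C from h)).not_gt hy
  have hTD : T ∈ D := by
    intro y hy
    rcases hy.lt_or_eq with hy | rfl
    · exact hDH y (hltT y hy)
    · refine hstep _ hT0 fun j hj => hDH _ (hltT _ ?_)
      have := nested_pos hM hG_pos (hs_pos _ hT0) hj.le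
      linarith
  have hTlt : ∀ y, y ∉ D → T < y := fun y hy => by
    by_contra! h
    exact hy (hlower T hTD y h)
  have hgap : ∀ j < k, ∃ ε > 0, ∀ y, T < y → y < T + ε →
      (∀ i < j, y - nested M G s i y ∈ D) → y - nested M G s j y ∈ D := by
    intro j hj
    obtain ⟨β, ρ, -, hρ⟩ := exists_heightLE_nested hM hMD hs hG hj.le
    by_contra! hcon
    let A : Set ℝ := {y | T < y ∧ (∀ i < j, y - nested M G s i y ∈ D) ∧
      y - nested M G s j y ∉ D}
    have hA : A.Nonempty := by
      obtain ⟨y, h1, -, h2⟩ := hcon 1 one_pos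
      exact ⟨y, h1, h2⟩
    obtain ⟨y, hy, hmin⟩ := exists_minimalFor_of_wellFoundedLT (· ∈ A) ρ hA
    have hy0 : 0 ≤ y := hT0.trans hy.1.le
    -- A counterexample y' closer to T than both y and T + nested M G s j y: its call lands right of
    -- T, so its nested value is below y' - T. Hence y' and y form a bad pair, against minimality of
    -- the rank.
    obtain ⟨y', h1, h2, h3, h4⟩ := hcon (min (y - T) (nested M G s j y))
      (lt_min (sub_pos.2 hy.1) (nested_pos hM hG_pos (hs_pos _ hy0) hj.le))
    have h5 : y' < y := by linarith [min_le_left (y - T) (nested M G s j y)]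
    have h6 : nested M G s j y' < nested M G s j y := by
      linarith [min_le_right (y - T) (nested M G s j y), hTlt _ h4]
    have h7 := hρ y ⟨hy0, hy.2.1⟩ y' ⟨hT0.trans h1.le, h3⟩ h5 h6
    exact (hmin ⟨h1, h3, h4⟩ h7.le).not_gt h7
  have hgap' : ∀ m ≤ k, ∃ ε > 0, ∀ y, T < y → y < T + ε →
      ∀ j < m, y - nested M G s j y ∈ D := by
    intro m
    induction m with
    | zero => exact fun _ => ⟨1, one_pos, by simp⟩
    | succ m ih =>
      intro hm
      obtain ⟨ε, hε, h1⟩ := ih (Nat.le_of_succ_le hm)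
      obtain ⟨ε', hε', h2⟩ := hgap m hm
      refine ⟨min ε ε', lt_min hε hε', fun y hy hy' j hj => ?_⟩
      have h3 := h1 y hy (hy'.trans_le (by gcongr; exact min_le_left _ _))
      rcases Nat.lt_succ_iff_lt_or_eq.1 hj with hj | rfl
      · exact h3 j hj
      · exact h2 y hy (hy'.trans_le (by gcongr; exact min_le_right _ _)) h3
  obtain ⟨ε, hε, h⟩ := hgap' k le_rfl
  obtain ⟨c, hc, hcT⟩ := exists_lt_of_csInf_lt hne (show sInf C < T + ε by linarith)
  refine hc fun y hy => ?_
  rcases le_or_gt y T with hyT | hyT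
  · exact hTD y hyT
  · exact hstep y (hT0.trans hyT.le) fun j hj => hDH _ (h y hyT (hy.trans_lt hcT) j hj)

/-! ### The algorithm as a nested recursion. -/

section Algorithm

variable {f s : ℝ → ℝ} {k : ℕ} {g : Fin k → ℝ → ℝ}

theorem Computes.unique {x y y' : ℝ} (h : Computes f s g x y) (h' : Computes f s g x y') :
    y = y' := by
  induction h generalizing y' with
  | neg hx =>
    cases h' with
    | neg _ => rfl
    | nonneg hx' => exact absurd hx hx'.not_gt
  | nonneg hx z r hlast hcall hpos hstep ih =>
    cases h' with
    | neg hx' => exact absurd hx' hx.not_gt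
    | nonneg _ z' r' hlast' hcall' hpos' hstep' =>
      have key : ∀ i, z i = z' i := by
        intro i
        induction i using Fin.reverseInduction with
        | last => rw [hlast, hlast']
        | cast i hi => rw [hstep, hstep', ih i (y' := r' i) (by rw [hi]; exact hcall' i)]
      exact key 0

theorem Computes.pos (hk : 0 < k) (hf_pos : ∀ x < 0, 0 < f x)
    (hg_pos : ∀ i, ∀ x < 0, 0 < g i x) {x y : ℝ} (h : Computes f s g x y) : 0 < y := by
  cases h with
  | neg hx => exact hf_pos x hx
  | nonneg hx z r hlast hcall hpos hstep =>
    have : z (Fin.castSucc ⟨0, hk⟩) = _ := hstep ⟨0, hk⟩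
    exact this ▸ hg_pos _ _ (hpos _)

/-- The functions `g` in the order in which they are applied, from the inside to the outside. -/
def innerFirst (g : Fin k → ℝ → ℝ) (j : ℕ) : ℝ → ℝ :=
  if h : j < k then g (Fin.rev ⟨j, h⟩) else fun _ => 0

/-- `nested` counts levels from the inside, the algorithm from the outside. -/
theorem innerFirst_sub (g : Fin k → ℝ → ℝ) (i : Fin k) : innerFirst g (k - (i + 1)) = g i := by
  have h : k - (i + 1 : ℕ) < k := by omega
  rw [innerFirst, dif_pos h]
  congr 1
  ext
  simp only [Fin.val_rev]
  omega

theorem forall_innerFirst {p : (ℝ → ℝ) → Prop} (h : ∀ i, p (g i)) : ∀ j < k, p (innerFirst g j) := by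
  intro j hj
  rw [innerFirst, dif_pos hj]
  exact h _

open Classical in
/-- The function computed by the algorithm, and `1` where it does not halt. -/
noncomputable def output (f s : ℝ → ℝ) (g : Fin k → ℝ → ℝ) (x : ℝ) : ℝ :=
  if h : ∃ y, Computes f s g x y then h.choose else 1

theorem computes_output {x : ℝ} (h : ∃ y, Computes f s g x y) :
    Computes f s g x (output f s g x) := by
  rw [output, dif_pos h]
  exact h.choose_spec

theorem Computes.eq_output {x y : ℝ} (h : Computes f s g x y) : y = output f s g x :=
  h.unique (computes_output ⟨y, h⟩)

theorem output_pos (hk : 0 < k) (hf_pos : ∀ x < 0, 0 < f x)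
    (hg_pos : ∀ i, ∀ x < 0, 0 < g i x) (x : ℝ) : 0 < output f s g x := by
  by_cases h : ∃ y, Computes f s g x y
  · exact (computes_output h).pos hk hf_pos hg_pos
  · rw [output, dif_neg h]
    exact one_pos

theorem Computes.eq_nested {x y : ℝ} (hx : 0 ≤ x) (h : Computes f s g x y) :
    y = nested (output f s g) (innerFirst g) s k x := by
  cases h with
  | neg hx' => exact absurd hx' hx.not_gt
  | nonneg _ z r hlast hcall hpos hstep =>
    have key : ∀ i : Fin (k + 1), z i = nested (output f s g) (innerFirst g) s (k - i) x := by
      intro i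
      induction i using Fin.reverseInduction with
      | last =>
        rw [hlast, Fin.val_last, Nat.sub_self]
        rfl
      | cast i hi =>
        have hki : k - (i.castSucc : ℕ) = k - (i + 1) + 1 := by
          rw [Fin.val_castSucc]
          omega
        rw [hstep, hki, nested_succ, innerFirst_sub, (hcall i).eq_output, hi, Fin.val_succ]
    simpa using key 0

theorem computes_nested {x : ℝ} (hx : 0 ≤ x) (hpos : ∀ x, 0 < output f s g x)
    (h : ∀ j < k, ∃ y, Computes f s g (x - nested (output f s g) (innerFirst g) s j x) y) :
    ∃ y, Computes f s g x y := by
  refine ⟨_, Computes.nonneg hx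
    (fun i : Fin (k + 1) => nested (output f s g) (innerFirst g) s (k - i) x)
    (fun i => output f s g (x - nested (output f s g) (innerFirst g) s (k - (i + 1)) x))
    ?_ ?_ (fun i => neg_lt_zero.2 (hpos _)) ?_⟩
  · simp only [Fin.val_last, Nat.sub_self]
    rfl
  · intro i
    exact computes_output (h (k - (i + 1)) (by omega))
  · intro i
    have hki : k - (i.castSucc : ℕ) = k - (i + 1) + 1 := by
      rw [Fin.val_castSucc]
      omega
    rw [hki, nested_succ, innerFirst_sub]

theorem isNestedRec_output (hk : 0 < k) (hf_pos : ∀ x < 0, 0 < f x)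
    (hs_pos : ∀ x, 0 ≤ x → 0 < s x) (hg_pos : ∀ i, ∀ x < 0, 0 < g i x) {D : Set ℝ}
    (hD : IsLowerSet D) (hhalt : ∀ x ∈ D, ∃ y, Computes f s g x y) :
    IsNestedRec k (output f s g) D (D ∩ Ici 0) s (innerFirst g) where
  lower := hD
  subset := inter_subset_left
  nonneg := inter_subset_right
  M_pos x _ := output_pos hk hf_pos hg_pos x
  s_pos x hx := hs_pos x hx.2
  G_pos := forall_innerFirst (p := fun G => ∀ x < 0, 0 < G x) hg_pos
  eq x hx := (computes_output (hhalt x hx.1)).eq_nested hx.2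

theorem heightLE_output_diff {D : Set ℝ} {α : Ordinal.{0}} (hf : HeightLE f (Iio 0) α) :
    HeightLE (output f s g) (D \ (D ∩ Ici 0)) α := by
  have hsub : D \ (D ∩ Ici 0) ⊆ Iio 0 := fun x hx =>
    mem_Iio.2 (not_le.1 fun h => hx.2 ⟨hx.1, mem_Ici.2 h⟩)
  exact (hf.mono hsub le_rfl).congr fun x hx => (Computes.neg (hsub hx)).eq_output.symm

end Algorithm

/-! ### The theorem. -/

theorem theorem2 {k : ℕ} (hk : 1 ≤ k) (f s : ℝ → ℝ) (g : Fin k → ℝ → ℝ)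
    (hf : OrdinalDecreasingOn f (Set.Iio 0))
    (hs : OrdinalDecreasingOn s (Set.Ici 0))
    (hg : ∀ i, OrdinalDecreasingOn (g i) (Set.Iio 0))
    (hf_pos : ∀ x < 0, 0 < f x)
    (hs_pos : ∀ x, 0 ≤ x → 0 < s x)
    (hg_pos : ∀ i, ∀ x < 0, 0 < g i x) :
    ∃ M : ℝ → ℝ, (∀ x y, Computes f s g x y ↔ y = M x) ∧
      ∃ hM : OrdinalDecreasingOn M Set.univ,
        (k = 1 → ∀ γ : Ordinal.{0},
          hf.type < ω ^ (ω ^ γ) → hs.type < ω ^ (ω ^ γ) →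
          (∀ i, (hg i).type < ω ^ (ω ^ γ)) →
          hM.type ≤ ω ^ (ω ^ (γ + 1) * (hs.type + 1))) ∧
        (2 ≤ k → ∀ γ : Ordinal.{0},
          hf.type < Ordinal.veblen ((k - 1 : ℕ) : Ordinal.{0}) γ →
          hs.type < Ordinal.veblen ((k - 1 : ℕ) : Ordinal.{0}) γ →
          (∀ i, (hg i).type < Ordinal.veblen ((k - 1 : ℕ) : Ordinal.{0}) γ) →
          hM.type ≤ Ordinal.veblen ((k - 1 : ℕ) : Ordinal.{0}) (γ + hs.type + 1)) := by
  have hdiff : ∀ D : Set ℝ, HeightLE (output f s g) (D \ (D ∩ Ici 0)) hf.type := fun D =>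
    heightLE_output_diff hf.heightLE_type
  have hsN : ∀ D : Set ℝ, HeightLE s (D ∩ Ici 0) hs.type := fun D =>
    hs.heightLE_type.mono inter_subset_right le_rfl
  -- A crude bound for any initial segment of halting inputs, available before termination is known;
  -- the sharp bounds come at the end.
  have hheight : ∀ D : Set ℝ, IsLowerSet D → (∀ x ∈ D, ∃ y, Computes f s g x y) →
      ∃ α, HeightLE (output f s g) D α := by
    intro D hD hhalt
    obtain ⟨m, rfl⟩ : ∃ m, k = m + 1 := ⟨k - 1, by omega⟩
    set δ := max (max hf.type hs.type) (⨆ i, (hg i).type) + 1 with hδ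
    have hlt : ∀ α ≤ max (max hf.type hs.type) (⨆ i, (hg i).type),
        α < veblen ((m : Ordinal.{0}) + 1) δ := fun α hα =>
      (Order.lt_add_one_iff.2 hα).trans_le (right_le_veblen _ _)
    obtain ⟨α, -, h⟩ := nestedClosed_veblen m δ _ D _ s _
      (isNestedRec_output m.succ_pos hf_pos hs_pos hg_pos hD hhalt)
      ⟨_, hlt _ ((le_max_left _ _).trans (le_max_left _ _)), hdiff D⟩
      ⟨_, hlt _ ((le_max_right _ _).trans (le_max_left _ _)), hsN D⟩
      (forall_innerFirst (p := fun G => HeightLT G (Iio 0) _) fun i =>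
        ⟨_, hlt _ ((Ordinal.le_iSup (fun i => (hg i).type) i).trans (le_max_right _ _)),
          (hg i).heightLE_type⟩)
    exact ⟨α, h⟩
  have hpos : ∀ x, 0 < output f s g x := output_pos hk hf_pos hg_pos
  have hhalt : ∀ x, ∃ y, Computes f s g x y := by
    obtain ⟨α, hα⟩ := hheight {x | ∀ y ≤ x, ∃ v, Computes f s g y v}
      (fun x y hyx hx z hz => hx z (hz.trans hyx)) fun x hx => hx x le_rfl
    exact forall_of_nested_step hpos hs_pos
      (forall_innerFirst (p := fun G => ∀ x < 0, 0 < G x) hg_pos) hα hs.heightLE_type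
      (forall_innerFirst (p := fun G => ∃ β, HeightLE G (Iio 0) β) fun i =>
        ⟨_, (hg i).heightLE_type⟩)
      (fun x hx => ⟨_, Computes.neg hx⟩) fun x hx h => computes_nested hx hpos h
  have R := isNestedRec_output hk hf_pos hs_pos hg_pos isLowerSet_univ fun x _ => hhalt x
  obtain ⟨α, hα⟩ := hheight univ isLowerSet_univ fun x _ => hhalt x
  refine ⟨output f s g, fun x y => ⟨fun h => h.eq_output, fun h => h ▸ computes_output (hhalt x)⟩,
    OrdinalDecreasingOn.of_heightLE hα, ?_, ?_⟩
  · rintro rfl γ hfγ hsγ hgγ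
    obtain ⟨β, hβ, h⟩ := R.heightLT_one (hsN _) ⟨_, hfγ, hdiff _⟩
      ((hsN _).mono Subset.rfl hsγ.le)
      (forall_innerFirst (p := fun G => HeightLE G (Iio 0) (ω ^ (ω ^ γ)))
        (fun i => (hg i).heightLE_type.mono Subset.rfl (hgγ i).le) 0 one_pos)
    exact (OrdinalDecreasingOn.type_le _ h).trans hβ.le
  · intro hk2 γ hfγ hsγ hgγ
    obtain ⟨m, rfl⟩ : ∃ m, k = m + 1 + 1 := ⟨k - 2, by omega⟩
    rw [Nat.add_sub_cancel, Nat.cast_succ] at hfγ hsγ hgγ ⊢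
    -- Of the m + 2 levels, one is absorbed into s and the closure property handles the other m + 1.
    obtain ⟨β, hβ, h⟩ := IsNestedRec.heightLT_succ (nestedClosed_veblen m) R (hsN _)
      ⟨_, hfγ, hdiff _⟩ ⟨_, hsγ, hsN _⟩
      (forall_innerFirst (p := fun G => HeightLT G (Iio 0) _) fun i =>
        ⟨_, hgγ i, (hg i).heightLE_type⟩)
    exact (OrdinalDecreasingOn.type_le _ h).trans hβ.le
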